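/- **Formulas and proofs.** Formulas are built from variables with $\neg,\wedge,\vee$ (the constants $\bot,\top$ are abbreviations for $x\wedge\neg x$ and $x\vee\neg x$). A formula is in negation normal form (NNF) if $\neg$ occurs only directly in front of variables; $\mathrm{nnf}(\varphi)$ is the usual negation normal form and $\varphi' := \mathrm{nnf}(\neg\varphi)$. An orthologic sequent is an unordered pair $(\Gamma,\Delta)$ of annotated formulas $\varphi^L$ or $\varphi^R$. Given a set $A$ of sequents (axioms), the sequents *provable in orthologic from $A$* are those derivable by the rules (premises / conclusion) - (Ax) $/\ q$ for $q\in A$; (Hyp) $/\ \varphi^L,\varphi^R$; (Cut) $\Gamma,\varphi^R$ and $\varphi^L,\Delta\ /\ \Gamma,\Delta$; (Replace) $\Gamma,\Gamma\ /\ \Gamma,\Delta$; - ($\wedge$-L) $\varphi^L,\Delta\ /\ (\varphi\wedge\psi)^L,\Delta$ and $\psi^L,\Delta\ /\ (\varphi\wedge\psi)^L,\Delta$; ($\wedge$-R) $\Gamma,\varphi^R$ and $\Gamma,\psi^R\ /\ \Gamma,(\varphi\wedge\psi)^R$; - ($\vee$-L) $\varphi^L,\Delta$ and $\psi^L,\Delta\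 /\ (\varphi\vee\psi)^L,\Delta$; ($\vee$-R) $\Gamma,\varphi^R\ /\ \Gamma,(\varphi\vee\psi)^R$ and $\Gamma,\psi^R\ /\ \Gamma,(\varphi\vee\psi)^R$; - ($\neg$-L) $\Gamma,\varphi^R\ /\ \Gamma,(\neg\varphi)^L$; ($\neg$-R) $\varphi^L,\Delta\ /\ (\neg\varphi)^R,\Delta$. A *right-only NNF sequent* is an unordered pair $(\varphi,\psi)$ of NNF formulas, standing for $\varphi^R,\psi^R$. The *right-only calculus* derives right-only NNF sequents by Ax, Replace, $\wedge$-R, $\vee$-R as above, by Hyp in the form $/\ (x,\neg x)$ for variables $x$, and by Cut in the form $(\varphi,\gamma)$ and $(\gamma',\psi)\ /\ (\varphi,\psi)$. **The procedure `prove`$(s,A)$.** The input is a right-only NNF sequent $s$ and a finite set $A$ of right-only NNF sequents. Let $S$ be the set of all subformulas of $s$ and of the axioms, let $SF$ be $S$ together with all subformulas of $\varphi'$ for $\varphi\in S$, and let $AF$ be the set of all $a,a',b,b'$ with $(a,b)\in A$. Let $SF_\vee(a)$ be the set of disjunctions in $SF$ having $a$ as a disjunct, and $SF_\wedge(a)$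 the set of all $c$ such that $a\wedge c\in SF$ or $c\wedge a\in SF$. Initially, the set *proven* and the stack *worklist* both consist of the axioms and the sequents $(x,x')$ for the variables $x$ of the input, and all sets $P_{Cut}(a)$, $P_\wedge(b)(c)$ are empty. While the worklist is non-empty: 1. pop a sequent $(a,b)$; if $(a,b)=s$, return true; 2. if $a\in AF$, add $b$ to $P_{Cut}(a')$; if $b\in AF$, add $a$ to $P_{Cut}(b')$; 3. for every $\psi\in SF_\wedge(a)$, add to $P_\wedge(b)(\psi)$ the conjunction of $a$ and $\psi$ (i.e. those of $a\wedge\psi$, $\psi\wedge a$ that lie in $SF$); likewise with $a$ and $b$ exchanged; 4. for every $\varphi\in SF_\vee(a)\cup P_\wedge(b)(a)\cup P_{Cut}(a)$, if $(\varphi,b)$ is not in *proven*, add it to *proven* and push it on the worklist; then likewise with $(a,\varphi)$ for every $\varphi\in SF_\vee(b)\cup P_\wedge(a)(b)\cup P_{Cut}(b)$; 5. if $a=b$, then for every $\varphi\in SF$, if $(\varphi,a)$ is not in *proven*, add it to *proven* and push it on the worklist. When the worklist is empty, return false. The order in which sets are traversed, and in which the two formulas of an unordered pair are read, is arbitrary.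 **Theorem (correctness of the orthologic entailment algorithm).** Let $A$ be a finite set of right-only NNF sequents and $s$ a right-only NNF sequent. Whatever the order of traversal, `prove`$(s,A)$ terminates; it returns true if and only if $s$ is provable in orthologic from $A$, and false otherwise. Moreover, it returns true if and only if $s$ is derivable from $A$ in the right-only calculus. -/

import Mathlib

namespace OL

/-- Formulas over a set `V` of variables. The constants `⊥` and `⊤` are not primitive: they are
written `x ∧ ¬x` and `x ∨ ¬x`. -/
inductive Formula (V : Type*) where
  | var : V → Formula V
  | neg : Formula V → Formula V
  | conj : Formula V → Formula V → Formula V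
  | disj : Formula V → Formula V → Formula V
  deriving DecidableEq

namespace Formula

variable {V : Type*}

/-- Negation normal form: negation occurs only directly on top of variables. -/
def IsNNF : Formula V → Prop
  | var _ => True
  | neg (var _) => True
  | neg _ => False
  | conj φ ψ => IsNNF φ ∧ IsNNF ψ
  | disj φ ψ => IsNNF φ ∧ IsNNF ψ

/-- `nnfPol true φ` is the negation normal form of `φ`, and `nnfPol false φ` that of `¬φ`. -/
def nnfPol : Bool → Formula V → Formula V
  | true, var x => var x
  | false, var x => neg (var x)
  | p, neg φ => nnfPol (!p) φ
  | true, conj φ ψ => conj (nnfPol true φ) (nnfPol true ψ)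
  | false, conj φ ψ => disj (nnfPol false φ) (nnfPol false ψ)
  | true, disj φ ψ => disj (nnfPol true φ) (nnfPol true ψ)
  | false, disj φ ψ => conj (nnfPol false φ) (nnfPol false ψ)

def nnf (φ : Formula V) : Formula V := nnfPol true φ

def getInverse (φ : Formula V) : Formula V := nnf (neg φ)

variable [DecidableEq V]

def subformulas : Formula V → Finset (Formula V)
  | var x => {var x}
  | neg φ => insert (neg φ) (subformulas φ)
  | conj φ ψ => insert (conj φ ψ) (subformulas φ ∪ subformulas ψ)
  | disj φ ψ => insert (disj φ ψ) (subformulas φ ∪ subformulas ψ)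

def vars : Formula V → Finset V
  | var x => {x}
  | neg φ => vars φ
  | conj φ ψ => vars φ ∪ vars ψ
  | disj φ ψ => vars φ ∪ vars ψ

end Formula

/-! ### The orthologic proof system -/

/-- Annotated formulas: `L φ` stands for `φ` on the left of the sequent, `R φ` on the right. -/
inductive Annotated (V : Type*) where
  | L : Formula V → Annotated V
  | R : Formula V → Annotated V

open Formula Annotated

/-- Provability in orthologic from a set `A` of axioms. A sequent is an unordered pair of annotated
formulas. The one-premise rules for `∧` on the left and `∨` on the right apply to either
immediate subformula. -/
inductive Provable {V : Type*} (A : Set (Sym2 (Annotated V))) : Sym2 (Annotated V) → Prop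
  | ax {q : Sym2 (Annotated V)} : q ∈ A → Provable A q
  | hyp (φ : Formula V) : Provable A s(L φ, R φ)
  | cut {Γ Δ : Annotated V} (φ : Formula V) :
      Provable A s(Γ, R φ) → Provable A s(L φ, Δ) → Provable A s(Γ, Δ)
  | replace {Γ : Annotated V} (Δ : Annotated V) : Provable A s(Γ, Γ) → Provable A s(Γ, Δ)
  | and_left₁ {φ : Formula V} (ψ : Formula V) {Δ : Annotated V} :
      Provable A s(L φ, Δ) → Provable A s(L (conj φ ψ), Δ)
  | and_left₂ (φ : Formula V) {ψ : Formula V} {Δ : Annotated V} :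
      Provable A s(L ψ, Δ) → Provable A s(L (conj φ ψ), Δ)
  | and_right {Γ : Annotated V} {φ ψ : Formula V} :
      Provable A s(Γ, R φ) → Provable A s(Γ, R ψ) → Provable A s(Γ, R (conj φ ψ))
  | or_left {φ ψ : Formula V} {Δ : Annotated V} :
      Provable A s(L φ, Δ) → Provable A s(L ψ, Δ) → Provable A s(L (disj φ ψ), Δ)
  | or_right₁ {Γ : Annotated V} {φ : Formula V} (ψ : Formula V) :
      Provable A s(Γ, R φ) → Provable A s(Γ, R (disj φ ψ))
  | or_right₂ {Γ : Annotated V} (φ : Formula V) {ψ : Formula V} :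
      Provable A s(Γ, R ψ) → Provable A s(Γ, R (disj φ ψ))
  | neg_left {Γ : Annotated V} {φ : Formula V} :
      Provable A s(Γ, R φ) → Provable A s(Γ, L (neg φ))
  | neg_right {Δ : Annotated V} {φ : Formula V} :
      Provable A s(L φ, Δ) → Provable A s(R (neg φ), Δ)

/-- Right-only sequents: the unordered pair `s(φ, ψ)` stands for the sequent `φ^R, ψ^R`. -/
abbrev Sequent (V : Type*) := Sym2 (Formula V)

/-- A right-only sequent, seen as a sequent of the full proof system. -/
def Sequent.toAnnotated {V : Type*} (q : Sequent V) : Sym2 (Annotated V) := Sym2.map R q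

/-- The sequent consists of formulas in negation normal form. -/
def Sequent.IsNNF {V : Type*} (q : Sequent V) : Prop := ∀ φ ∈ q, φ.IsNNF

/-- Provability in the right-only calculus for formulas in negation normal form. -/
inductive RightProvable {V : Type*} (A : Set (Sequent V)) : Sequent V → Prop
  | ax {q : Sequent V} : q ∈ A → RightProvable A q
  | hyp (x : V) : RightProvable A s(var x, neg (var x))
  | cut {φ ψ : Formula V} (γ : Formula V) :
      RightProvable A s(φ, γ) → RightProvable A s(getInverse γ, ψ) → RightProvable A s(φ, ψ)
  | replace {φ : Formula V} (ψ : Formula V) :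
      ψ.IsNNF → RightProvable A s(φ, φ) → RightProvable A s(φ, ψ)
  | and_right {γ φ ψ : Formula V} :
      RightProvable A s(γ, φ) → RightProvable A s(γ, ψ) → RightProvable A s(γ, conj φ ψ)
  | or_right₁ {γ φ : Formula V} (ψ : Formula V) :
      ψ.IsNNF → RightProvable A s(γ, φ) → RightProvable A s(γ, disj φ ψ)
  | or_right₂ {γ : Formula V} (φ : Formula V) {ψ : Formula V} :
      φ.IsNNF → RightProvable A s(γ, ψ) → RightProvable A s(γ, disj φ ψ)

/-! ### The worklist procedure `prove` -/

section Algorithm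

variable {V : Type*} [DecidableEq V]

def Sequent.subformulas (q : Sequent V) : Finset (Formula V) :=
  q.toFinset.biUnion Formula.subformulas

/-- The set `SF`: all subformulas of the goal and of the axioms, together with all subformulas of
the inverses of these. -/
def allSubformulas (A : Finset (Sequent V)) (goal : Sequent V) : Finset (Formula V) :=
  let S := goal.subformulas ∪ A.biUnion Sequent.subformulas
  S ∪ S.biUnion fun φ => (getInverse φ).subformulas

def axiomFormulas (A : Finset (Sequent V)) : Finset (Formula V) :=
  A.biUnion fun q => q.toFinset ∪ q.toFinset.image getInverse

/-- The sequents with which `proven` and the worklist start: the axioms and all `(x, ¬x)` for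
variables `x` of the input. -/
def initialSequents (A : Finset (Sequent V)) (goal : Sequent V) : Finset (Sequent V) :=
  A ∪ ((allSubformulas A goal).biUnion vars).image fun x => s(var x, getInverse (var x))

/-- The map `SF_∨`: it sends `a` to the disjunctions in `SF` one of whose disjuncts is `a`. -/
def orMap (SF : Finset (Formula V)) (a : Formula V) : Finset (Formula V) :=
  SF.biUnion fun
    | disj φ₁ φ₂ => if a = φ₁ ∨ a = φ₂ then {disj φ₁ φ₂} else ∅
    | _ => ∅

/-- The map `SF_∧`: it sends `a` to the formulas `b` such that `SF` contains a conjunction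
of `a` and `b`. -/
def andMap (SF : Finset (Formula V)) (a : Formula V) : Finset (Formula V) :=
  SF.biUnion fun
    | conj φ₁ φ₂ => (if a = φ₁ then {φ₂} else ∅) ∪ (if a = φ₂ then {φ₁} else ∅)
    | _ => ∅

/-- The mutable data of the procedure; the head of the list `worklist` is the top of the stack. -/
structure State (V : Type*) where
  proven : Finset (Sequent V)
  worklist : List (Sequent V)
  PCut : Formula V → Finset (Formula V)
  PAnd : Formula V → Formula V → Finset (Formula V)

namespace State

/-- `if axiomFormulas.contains(a) then P_Cut(getInverse(a)) += b`. -/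
def recordCut (AF : Finset (Formula V)) (a b : Formula V) (σ : State V) : State V :=
  if a ∈ AF then
    { σ with PCut := Function.update σ.PCut (getInverse a) (insert b (σ.PCut (getInverse a))) }
  else σ

/-- `SF_∧(a).foreach{ψ => P_∧(b)(ψ) += a ∧ ψ}`. Membership of `ψ` in `SF_∧(a)` disregards the order
of the conjuncts, and so does the entry `a ∧ ψ`: it stands for the conjunctions of `a` and `ψ` that
occur in `SF`, in either order. -/
def recordAnd (SF : Finset (Formula V)) (a b : Formula V) (σ : State V) : State V :=
  { σ with
    PAnd := fun c ψ =>
      if c = b ∧ ψ ∈ andMap SF a then σ.PAnd c ψ ∪ ({conj a ψ, conj ψ a} ∩ SF) else σ.PAnd c ψ }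

/-- Add a sequent to `proven` and push it on the worklist, unless it is in `proven` already. -/
def tryAdd (σ : State V) (q : Sequent V) : State V :=
  if q ∈ σ.proven then σ
  else { σ with proven := insert q σ.proven, worklist := q :: σ.worklist }

/-- Running `tryAdd (f φ)` for every `φ ∈ S`, in some order, can lead from `σ` to `τ`. -/
def AddEach (S : Finset (Formula V)) (f : Formula V → Sequent V) (σ τ : State V) : Prop :=
  ∃ l : List (Formula V), l.Nodup ∧ l.toFinset = S ∧ τ = l.foldl (fun ρ φ => ρ.tryAdd (f φ)) σ

/-- The formulas `φ` for which `(φ, b)` is deduced from `(a, b)`: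
`SF_∨(a) ∪ P_∧(b)(a) ∪ P_Cut(a)`. -/
def consequences (SF : Finset (Formula V)) (σ : State V) (a b : Formula V) : Finset (Formula V) :=
  orMap SF a ∪ σ.PAnd b a ∪ σ.PCut a

/-- `σ` is a state at the start of the main loop: the stack lists the initial sequents
in some order. -/
def IsInitial (A : Finset (Sequent V)) (goal : Sequent V) (σ : State V) : Prop :=
  σ.proven = initialSequents A goal ∧
  σ.worklist.Nodup ∧ σ.worklist.toFinset = initialSequents A goal ∧
  σ.PCut = (fun _ => ∅) ∧ σ.PAnd = (fun _ _ => ∅)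

end State

/-- The procedure is either about to test the loop condition, or has returned a truth value. -/
inductive Config (V : Type*) where
  | running : State V → Config V
  | returned : Bool → Config V

/-- One iteration of the main loop. It is a relation and not a function because the order in which
sets are traversed, and the order in which the two formulas of an unordered pair are read, is left
open. -/
inductive Step (A : Finset (Sequent V)) (goal : Sequent V) : Config V → Config V → Prop
  | exhausted {σ : State V} : σ.worklist = [] → Step A goal (.running σ) (.returned false)
  | found {σ : State V} {w : List (Sequent V)} :
      σ.worklist = goal :: w → Step A goal (.running σ) (.returned true)
  | iterate {σ σ₀ σ₁ σ₂ σ₃ : State V} {a b : Formula V} {w : List (Sequent V)} :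
      σ.worklist = s(a, b) :: w →
      s(a, b) ≠ goal →
      σ₀ = ((((({ σ with worklist := w } : State V).recordCut (axiomFormulas A) a b).recordCut
        (axiomFormulas A) b a).recordAnd (allSubformulas A goal) a b).recordAnd
        (allSubformulas A goal) b a) →
      σ₀.AddEach (σ₀.consequences (allSubformulas A goal) a b) (fun φ => s(φ, b)) σ₁ →
      σ₁.AddEach (σ₁.consequences (allSubformulas A goal) b a) (fun φ => s(a, φ)) σ₂ →
      σ₂.AddEach (if a = b then allSubformulas A goal else ∅) (fun φ => s(φ, a)) σ₃ →
      Step A goal (.running σ) (.running σ₃)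

/-- Every run from the given configuration terminates, and returns `r`. -/
inductive EveryRunReturns (A : Finset (Sequent V)) (goal : Sequent V) (r : Bool) : Config V → Prop
  | returned : EveryRunReturns A goal r (.returned r)
  | step {c : Config V} : (∃ c', Step A goal c c') →
      (∀ c', Step A goal c c' → EveryRunReturns A goal r c') → EveryRunReturns A goal r c

/-- `prove(goal, A)` terminates with result `r`, in whatever order sets are traversed. -/
def ProveReturns (A : Finset (Sequent V)) (goal : Sequent V) (r : Bool) : Prop :=
  ∀ σ : State V, σ.IsInitial A goal → EveryRunReturns A goal r (.running σ)

end Algorithm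

end OL

/-! The chain is: returned true ⇒ right-only derivable ⇒ provable in orthologic ⇒ returned true. The
first implication holds because every sequent ever added is right-only derivable
(`State.Invariant`); the second simulates each right-only rule (`RightProvable.provable`).

The third is semantic and replaces syntactic cut elimination. When the worklist is empty, the set
`T` of proven sequents is saturated: closed under the right-only rules with conclusions over the
finite set `SF`, cuts being made only on formulas of `AF`. Relate two formulas of `SF` when they
form a sequent of `T`. Sets fixed by the double polar of this symmetric relation interpret
orthologic, with polar as negation, and all its rules, unrestricted cut included, preserve validity
(`Provable.valid`). With `x` interpreted as the polar of `{x}`, the interpretation of an NNF formula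
`φ ∈ SF` lies inside the polar of `{φ}` (`Saturated.sequent_mem_of_mem_interp`). For `φ ∈ AF` the
cuts in `T` give equality, which makes the axioms valid. So a provable goal is valid, and the
inclusion turns its validity into membership in `T` (`Saturated.complete`).

Termination: a sequent is pushed only when it is new in `proven`, so the number of unproven sequents
over `SF` plus the length of the worklist drops by one at each iteration. -/

namespace OL

/-! ### Negation normal forms and subformulas -/

namespace Formula

variable {V : Type*}

theorem getInverse_eq_nnfPol (φ : Formula V) : getInverse φ = nnfPol false φ := by
  simp [getInverse, nnf, nnfPol]

theorem isNNF_nnfPol (φ : Formula V) : ∀ p, (nnfPol p φ).IsNNF := by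
  induction φ with
  | var x => intro p; cases p <;> simp [nnfPol, IsNNF]
  | neg φ ih => intro p; simpa [nnfPol] using ih (!p)
  | conj φ ψ ih₁ ih₂ => intro p; cases p <;> simp [nnfPol, IsNNF, ih₁, ih₂]
  | disj φ ψ ih₁ ih₂ => intro p; cases p <;> simp [nnfPol, IsNNF, ih₁, ih₂]

theorem isNNF_getInverse (φ : Formula V) : (getInverse φ).IsNNF := by
  rw [getInverse_eq_nnfPol]
  exact isNNF_nnfPol φ false

theorem nnfPol_false_nnfPol (φ : Formula V) : ∀ p, nnfPol false (nnfPol p φ) = nnfPol (!p) φ := by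
  induction φ with
  | var x => intro p; cases p <;> simp [nnfPol]
  | neg φ ih => intro p; simpa [nnfPol] using ih (!p)
  | conj φ ψ ih₁ ih₂ => intro p; cases p <;> simp [nnfPol, ih₁, ih₂]
  | disj φ ψ ih₁ ih₂ => intro p; cases p <;> simp [nnfPol, ih₁, ih₂]

theorem nnfPol_true_of_isNNF (φ : Formula V) (h : φ.IsNNF) : nnfPol true φ = φ := by
  induction φ with
  | var x => simp [nnfPol]
  | neg φ ih => cases φ <;> simp_all [nnfPol, IsNNF]
  | conj φ ψ ih₁ ih₂ => simp [nnfPol, ih₁ h.1, ih₂ h.2]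
  | disj φ ψ ih₁ ih₂ => simp [nnfPol, ih₁ h.1, ih₂ h.2]

/-- In general the double inverse is `nnf φ`, so normality is needed for an involution. -/
theorem getInverse_getInverse {φ : Formula V} (h : φ.IsNNF) : getInverse (getInverse φ) = φ := by
  rw [getInverse_eq_nnfPol, getInverse_eq_nnfPol, nnfPol_false_nnfPol]
  exact nnfPol_true_of_isNNF φ h

variable [DecidableEq V]

theorem mem_subformulas_self (φ : Formula V) : φ ∈ subformulas φ := by
  cases φ <;> simp [subformulas]

theorem subformulas_subset {φ ψ : Formula V} (h : ψ ∈ subformulas φ) :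
    subformulas ψ ⊆ subformulas φ := by
  induction φ with
  | var x => simp_all [subformulas]
  | neg φ ih =>
    simp only [subformulas, Finset.mem_insert] at h ⊢
    rcases h with rfl | h
    · simp [subformulas]
    · exact (ih h).trans (Finset.subset_insert _ _)
  | conj φ₁ φ₂ ih₁ ih₂ =>
    simp only [subformulas, Finset.mem_insert, Finset.mem_union] at h ⊢
    rcases h with rfl | h | h
    · simp [subformulas]
    · exact (ih₁ h).trans (Finset.subset_union_left.trans (Finset.subset_insert _ _))
    · exact (ih₂ h).trans (Finset.subset_union_right.trans (Finset.subset_insert _ _))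
  | disj φ₁ φ₂ ih₁ ih₂ =>
    simp only [subformulas, Finset.mem_insert, Finset.mem_union] at h ⊢
    rcases h with rfl | h | h
    · simp [subformulas]
    · exact (ih₁ h).trans (Finset.subset_union_left.trans (Finset.subset_insert _ _))
    · exact (ih₂ h).trans (Finset.subset_union_right.trans (Finset.subset_insert _ _))

theorem IsNNF.of_mem_subformulas {φ ψ : Formula V} (hφ : φ.IsNNF) (h : ψ ∈ subformulas φ) :
    ψ.IsNNF := by
  induction φ with
  | var x => simp_all [subformulas]
  | neg φ ih =>
    cases φ with
    | var x =>
      simp only [subformulas, Finset.mem_insert, Finset.mem_singleton] at h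
      rcases h with rfl | rfl <;> trivial
    | _ => exact hφ.elim
  | conj φ₁ φ₂ ih₁ ih₂ =>
    simp only [subformulas, Finset.mem_insert, Finset.mem_union] at h
    rcases h with rfl | h | h
    exacts [hφ, ih₁ hφ.1 h, ih₂ hφ.2 h]
  | disj φ₁ φ₂ ih₁ ih₂ =>
    simp only [subformulas, Finset.mem_insert, Finset.mem_union] at h
    rcases h with rfl | h | h
    exacts [hφ, ih₁ hφ.1 h, ih₂ hφ.2 h]

theorem mem_vars_iff (x : V) (φ : Formula V) : x ∈ vars φ ↔ var x ∈ subformulas φ := by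
  induction φ <;> simp_all [vars, subformulas]

theorem vars_nnfPol (φ : Formula V) : ∀ p, vars (nnfPol p φ) = vars φ := by
  induction φ with
  | var x => intro p; cases p <;> simp [nnfPol, vars]
  | neg φ ih => intro p; simpa [nnfPol, vars] using ih (!p)
  | conj φ ψ ih₁ ih₂ => intro p; cases p <;> simp [nnfPol, vars, ih₁, ih₂]
  | disj φ ψ ih₁ ih₂ => intro p; cases p <;> simp [nnfPol, vars, ih₁, ih₂]

end Formula

open Formula Annotated

/-! ### From the right-only calculus to orthologic -/

section Translation

variable {V : Type*}

theorem Provable.swap {A : Set (Sym2 (Annotated V))} {Γ Δ : Annotated V}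
    (h : Provable A s(Γ, Δ)) : Provable A s(Δ, Γ) := by
  rwa [Sym2.eq_swap]

/-- The two claims say that `nnf φ` entails `φ` and that `nnf (¬φ)` contradicts `φ`. They are proved
together because negation exchanges them. -/
theorem Provable.nnfPol_left (A : Set (Sym2 (Annotated V))) (φ : Formula V) :
    Provable A s(L (nnfPol true φ), R φ) ∧ Provable A s(L (nnfPol false φ), L φ) := by
  induction φ with
  | var x => exact ⟨.hyp _, .swap (.neg_left (.hyp _))⟩
  | neg φ ih =>
    simp only [nnfPol, Bool.not_true, Bool.not_false]
    exact ⟨.swap (.neg_right ih.2.swap), .neg_left ih.1⟩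
  | conj φ ψ ih₁ ih₂ =>
    simp only [nnfPol]
    exact ⟨.and_right (.and_left₁ _ ih₁.1) (.and_left₂ _ ih₂.1),
      .or_left (.swap (.and_left₁ _ ih₁.2.swap)) (.swap (.and_left₂ _ ih₂.2.swap))⟩
  | disj φ ψ ih₁ ih₂ =>
    simp only [nnfPol]
    exact ⟨.or_left (.or_right₁ _ ih₁.1) (.or_right₂ _ ih₂.1),
      .swap (.or_left (.swap (.and_left₁ _ ih₁.2)) (.swap (.and_left₂ _ ih₂.2)))⟩

theorem RightProvable.provable {A : Set (Sequent V)} {q : Sequent V} (h : RightProvable A q) :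
    Provable (Sequent.toAnnotated '' A) q.toAnnotated := by
  induction h with
  | ax hq => exact .ax ⟨_, hq, rfl⟩
  | hyp x => exact .swap (.neg_right (.hyp _))
  | cut γ _ _ ih₁ ih₂ =>
    rw [getInverse_eq_nnfPol] at ih₂
    -- A cut on the inverse of `γ` against the second claim of `Provable.nnfPol_left` turns the
    -- right premise into one with `γ` on the left.
    exact .cut γ ih₁ (.swap (.cut _ ih₂.swap (Provable.nnfPol_left _ γ).2))
  | replace ψ _ _ ih => exact .replace _ ih
  | and_right _ _ ih₁ ih₂ => exact .and_right ih₁ ih₂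
  | or_right₁ ψ _ _ ih => exact .or_right₁ _ ih
  | or_right₂ φ _ _ ih => exact .or_right₂ _ ih

theorem RightProvable.swap {A : Set (Sequent V)} {φ ψ : Formula V}
    (h : RightProvable A s(φ, ψ)) : RightProvable A s(ψ, φ) := by
  rwa [Sym2.eq_swap]

end Translation

/-! ### Soundness of orthologic in the ortholattice of closed sets of a symmetric relation -/

section Semantics

variable {V W : Type*} (r : W → W → Prop)

/-- The set of all points related to every point of `X`. -/
def polar (X : Set W) : Set W := {w | ∀ x ∈ X, r w x}

/-- Interpretation of formulas by sets of points, disjunction being the De Morgan dual of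
intersection. -/
def interp (v : V → Set W) : Formula V → Set W
  | var x => v x
  | neg φ => polar r (interp v φ)
  | conj φ ψ => interp v φ ∩ interp v ψ
  | disj φ ψ => polar r (polar r (interp v φ) ∩ polar r (interp v ψ))

/-- Interpretation of annotated formulas: a formula on the left counts as negated. -/
def interpAnnotated (v : V → Set W) : Annotated V → Set W
  | L φ => polar r (interp r v φ)
  | R φ => interp r v φ

variable {r}

theorem polar_anti {X Y : Set W} (h : X ⊆ Y) : polar r Y ⊆ polar r X :=
  fun _ hw x hx => hw x (h hx)

theorem subset_polar_polar (hsymm : ∀ x y, r x y → r y x) (X : Set W) :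
    X ⊆ polar r (polar r X) :=
  fun _ hx _ hy => hsymm _ _ (hy _ hx)

theorem polar_polar_polar (hsymm : ∀ x y, r x y → r y x) (X : Set W) :
    polar r (polar r (polar r X)) = polar r X :=
  (polar_anti (subset_polar_polar hsymm X)).antisymm (subset_polar_polar hsymm _)

theorem polar_polar_inter (hsymm : ∀ x y, r x y → r y x) {X Y : Set W}
    (hX : polar r (polar r X) = X) (hY : polar r (polar r Y) = Y) :
    polar r (polar r (X ∩ Y)) = X ∩ Y := by
  refine Set.Subset.antisymm (Set.subset_inter ?_ ?_) (subset_polar_polar hsymm _)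
  · exact (polar_anti (polar_anti Set.inter_subset_left)).trans hX.subset
  · exact (polar_anti (polar_anti Set.inter_subset_right)).trans hY.subset

variable {v : V → Set W}

theorem polar_polar_interp (hsymm : ∀ x y, r x y → r y x)
    (hv : ∀ x, polar r (polar r (v x)) = v x) (φ : Formula V) :
    polar r (polar r (interp r v φ)) = interp r v φ := by
  induction φ with
  | var x => exact hv x
  | neg φ _ => exact polar_polar_polar hsymm _
  | conj φ ψ ih₁ ih₂ => exact polar_polar_inter hsymm ih₁ ih₂
  | disj φ ψ _ _ => exact polar_polar_polar hsymm _

theorem polar_polar_interpAnnotated (hsymm : ∀ x y, r x y → r y x)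
    (hv : ∀ x, polar r (polar r (v x)) = v x) (Γ : Annotated V) :
    polar r (polar r (interpAnnotated r v Γ)) = interpAnnotated r v Γ := by
  cases Γ with
  | L φ => exact polar_polar_polar hsymm _
  | R φ => exact polar_polar_interp hsymm hv φ

theorem interp_nnfPol (hsymm : ∀ x y, r x y → r y x)
    (hv : ∀ x, polar r (polar r (v x)) = v x) (φ : Formula V) :
    interp r v (nnfPol true φ) = interp r v φ ∧
      interp r v (nnfPol false φ) = polar r (interp r v φ) := by
  have hc := polar_polar_interp hsymm hv
  induction φ with
  | var x => exact ⟨rfl, rfl⟩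
  | neg φ ih =>
    simp only [nnfPol, Bool.not_true, Bool.not_false, interp]
    exact ⟨ih.2, by rw [ih.1, hc]⟩
  | conj φ ψ ih₁ ih₂ => simp [nnfPol, interp, ih₁, ih₂, hc]
  | disj φ ψ ih₁ ih₂ =>
    refine ⟨by simp [nnfPol, interp, ih₁, ih₂], ?_⟩
    simp only [nnfPol, interp, ih₁, ih₂]
    exact (polar_polar_inter hsymm (polar_polar_polar hsymm _) (polar_polar_polar hsymm _)).symm

theorem interp_getInverse (hsymm : ∀ x y, r x y → r y x)
    (hv : ∀ x, polar r (polar r (v x)) = v x) (φ : Formula V) :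
    interp r v (getInverse φ) = polar r (interp r v φ) := by
  rw [getInverse_eq_nnfPol]
  exact (interp_nnfPol hsymm hv φ).2

variable (r v) in
/-- A sequent is valid if the complements of its two members are orthogonal. -/
def Valid (q : Sym2 (Annotated V)) : Prop :=
  ∀ Γ Δ, q = s(Γ, Δ) →
    polar r (interpAnnotated r v Γ) ⊆ interpAnnotated r v Δ

/-- One reading of the pair suffices: taking polars reverses the inclusion, and interpretations are
fixed by the double polar. -/
theorem valid_mk (hsymm : ∀ x y, r x y → r y x)
    (hv : ∀ x, polar r (polar r (v x)) = v x) {Γ Δ : Annotated V} :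
    Valid r v s(Γ, Δ) ↔ polar r (interpAnnotated r v Γ) ⊆ interpAnnotated r v Δ := by
  refine ⟨fun h => h _ _ rfl, fun h Γ' Δ' e => ?_⟩
  rcases Sym2.eq_iff.1 e with ⟨rfl, rfl⟩ | ⟨rfl, rfl⟩
  · exact h
  · exact (polar_anti h).trans (polar_polar_interpAnnotated hsymm hv _).subset

theorem valid_mk' (hsymm : ∀ x y, r x y → r y x)
    (hv : ∀ x, polar r (polar r (v x)) = v x) {Γ Δ : Annotated V} :
    Valid r v s(Γ, Δ) ↔ polar r (interpAnnotated r v Δ) ⊆ interpAnnotated r v Γ := by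
  rw [Sym2.eq_swap, valid_mk hsymm hv]

theorem Provable.valid (hsymm : ∀ x y, r x y → r y x) (hzero : ∀ x, r x x → ∀ y, r x y)
    (hv : ∀ x, polar r (polar r (v x)) = v x) {A : Set (Sym2 (Annotated V))}
    (hA : ∀ q ∈ A, Valid r v q) {q : Sym2 (Annotated V)} (h : Provable A q) : Valid r v q := by
  have hc := polar_polar_interp hsymm hv
  have hca := polar_polar_interpAnnotated hsymm hv
  induction h with
  | ax hq => exact hA _ hq
  | hyp φ => exact (valid_mk hsymm hv).2 (hc φ).subset
  | cut φ _ _ ih₁ ih₂ =>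
    rw [valid_mk hsymm hv] at *
    exact ih₁.trans ((hc φ).superset.trans ih₂)
  -- A point of both `Γ` and its polar is related to itself, hence by `hzero` to everything, so it
  -- lies in every set fixed by the double polar.
  | @replace Γ Δ _ ih =>
    rw [valid_mk hsymm hv] at *
    intro w hw
    rw [← hca]
    exact fun y _ => hzero w (hw w (ih hw)) y
  | and_left₁ ψ _ ih =>
    rw [valid_mk' hsymm hv] at *
    exact ih.trans (polar_anti Set.inter_subset_left)
  | and_left₂ φ _ ih =>
    rw [valid_mk' hsymm hv] at *
    exact ih.trans (polar_anti Set.inter_subset_right)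
  | and_right _ _ ih₁ ih₂ =>
    rw [valid_mk hsymm hv] at *
    exact Set.subset_inter ih₁ ih₂
  | or_left _ _ ih₁ ih₂ =>
    rw [valid_mk' hsymm hv] at *
    exact (Set.subset_inter ih₁ ih₂).trans (subset_polar_polar hsymm _)
  | or_right₁ ψ _ ih =>
    rw [valid_mk hsymm hv] at *
    exact (ih.trans (hc _).superset).trans (polar_anti Set.inter_subset_left)
  | or_right₂ φ _ ih =>
    rw [valid_mk hsymm hv] at *
    exact (ih.trans (hc _).superset).trans (polar_anti Set.inter_subset_right)
  | neg_left _ ih =>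
    rw [valid_mk hsymm hv] at *
    exact ih.trans (hc _).superset
  | neg_right _ ih =>
    rw [valid_mk' hsymm hv] at *
    exact ih

end Semantics

/-! ### Completeness of saturated sets of sequents -/

section Saturation

variable {V : Type*}

/-- The set `T` of sequents over `SF` is closed under the rules of the right-only calculus with
conclusions over `SF`, where cuts are restricted to formulas of `AF`. -/
structure Saturated (SF AF : Set (Formula V)) (T : Set (Sequent V)) : Prop where
  hyp : ∀ x, var x ∈ SF → s(var x, neg (var x)) ∈ T
  cut : ∀ a ∈ AF, ∀ b c, s(b, a) ∈ T → s(getInverse a, c) ∈ T → s(b, c) ∈ T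
  replace : ∀ a, s(a, a) ∈ T → ∀ b ∈ SF, s(a, b) ∈ T
  and_right : ∀ a b c, conj a b ∈ SF → s(c, a) ∈ T → s(c, b) ∈ T → s(c, conj a b) ∈ T
  or_right₁ : ∀ a b c, disj a b ∈ SF → s(c, a) ∈ T → s(c, disj a b) ∈ T
  or_right₂ : ∀ a b c, disj a b ∈ SF → s(c, b) ∈ T → s(c, disj a b) ∈ T

/-- The relation on formulas of `SF` given by a set of sequents. -/
def sequentRel (SF : Set (Formula V)) (T : Set (Sequent V)) (a b : SF) : Prop :=
  s(a.1, b.1) ∈ T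

/-- The valuation sending a variable to the formulas that form a sequent of `T` with it. -/
def canonicalVal (SF : Set (Formula V)) (T : Set (Sequent V)) (x : V) : Set SF :=
  polar (sequentRel SF T) {w | w.1 = var x}

variable {SF AF : Set (Formula V)} {T : Set (Sequent V)}

theorem sequentRel_symm (x y : SF) (h : sequentRel SF T x y) : sequentRel SF T y x := by
  unfold sequentRel at *
  rwa [Sym2.eq_swap]

theorem polar_polar_canonicalVal (x : V) :
    polar (sequentRel SF T) (polar (sequentRel SF T) (canonicalVal SF T x)) =
      canonicalVal SF T x :=
  polar_polar_polar sequentRel_symm _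

/-- Truth lemma, in one direction only. Hyp, `∧`-R and `∨`-R suffice for it; cuts are needed only
for the converse on `AF`. -/
theorem Saturated.sequent_mem_of_mem_interp [DecidableEq V] (hT : Saturated SF AF T)
    (hsub : ∀ φ ∈ SF, ∀ ψ ∈ φ.subformulas, ψ ∈ SF) (φ : Formula V) (hnnf : φ.IsNNF) (hφ : φ ∈ SF)
    (w : SF) (hw : w ∈ interp (sequentRel SF T) (canonicalVal SF T) φ) :
    s(w.1, φ) ∈ T := by
  induction φ generalizing w with
  | var x => exact hw ⟨var x, hφ⟩ rfl
  | neg φ _ =>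
    cases φ with
    | var x =>
      have hx : var x ∈ SF := hsub _ hφ _ (by simp [subformulas])
      refine hw ⟨_, hφ⟩ ?_
      rintro ⟨_, _⟩ rfl
      exact sequentRel_symm ⟨var x, hx⟩ ⟨_, hφ⟩ (hT.hyp x hx)
    | _ => exact hnnf.elim
  | conj φ ψ ih₁ ih₂ =>
    have h₁ : φ ∈ SF := hsub _ hφ _ (by simp [subformulas, mem_subformulas_self])
    have h₂ : ψ ∈ SF := hsub _ hφ _ (by simp [subformulas, mem_subformulas_self])
    exact hT.and_right _ _ _ hφ (ih₁ hnnf.1 h₁ w hw.1) (ih₂ hnnf.2 h₂ w hw.2)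
  | disj φ ψ ih₁ ih₂ =>
    have h₁ : φ ∈ SF := hsub _ hφ _ (by simp [subformulas, mem_subformulas_self])
    have h₂ : ψ ∈ SF := hsub _ hφ _ (by simp [subformulas, mem_subformulas_self])
    -- The disjunction itself is the test point: `∨`-R relates it to every point of either
    -- disjunct's interpretation.
    refine hw ⟨_, hφ⟩ ⟨fun u hu => ?_, fun u hu => ?_⟩
    · exact sequentRel_symm u ⟨_, hφ⟩ (hT.or_right₁ _ _ _ hφ (ih₁ hnnf.1 h₁ u hu))
    · exact sequentRel_symm u ⟨_, hφ⟩ (hT.or_right₂ _ _ _ hφ (ih₂ hnnf.2 h₂ u hu))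

/-- A saturated set contains every sequent over `SF` that is provable in orthologic. -/
theorem Saturated.complete [DecidableEq V] (hT : Saturated SF AF T)
    (hsub : ∀ φ ∈ SF, ∀ ψ ∈ φ.subformulas, ψ ∈ SF) (hnnf : ∀ φ ∈ SF, φ.IsNNF)
    (hinv : ∀ φ ∈ AF, φ ∈ SF ∧ getInverse φ ∈ SF)
    {A : Set (Sequent V)} (hA : A ⊆ T) (hAF : ∀ q ∈ A, ∀ φ ∈ q, φ ∈ AF)
    {q : Sequent V} (hq : ∀ φ ∈ q, φ ∈ SF)
    (h : Provable (Sequent.toAnnotated '' A) q.toAnnotated) : q ∈ T := by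
  have key := hT.sequent_mem_of_mem_interp hsub
  have hpolar : ∀ φ (hφ : φ ∈ SF), (⟨φ, hφ⟩ : SF) ∈
      polar (sequentRel SF T) (interp (sequentRel SF T) (canonicalVal SF T) φ) :=
    fun φ hφ w hw => sequentRel_symm w ⟨φ, hφ⟩ (key φ (hnnf φ hφ) hφ w hw)
  -- Converse of the truth lemma on `AF`: points in the interpretation of the inverse of `a` form
  -- sequents with that inverse, so a cut on `a` relates them to `w`.
  have hmem : ∀ a ∈ AF, ∀ w : SF, s(w.1, a) ∈ T →
      w ∈ interp (sequentRel SF T) (canonicalVal SF T) a := by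
    intro a ha w hw
    rw [← polar_polar_interp sequentRel_symm polar_polar_canonicalVal a,
      ← interp_getInverse sequentRel_symm polar_polar_canonicalVal]
    intro u hu
    have := key _ (isNNF_getInverse a) (hinv a ha).2 u hu
    rw [Sym2.eq_swap] at this
    exact hT.cut a ha _ _ hw this
  have hvalid := h.valid (r := sequentRel SF T) (v := canonicalVal SF T) sequentRel_symm
    (fun x hx y => hT.replace _ hx _ y.2) polar_polar_canonicalVal ?_
  · induction q using Sym2.ind with
    | _ a b =>
      have ha := hq a (by simp)
      have hb := hq b (by simp)
      have := hvalid (R a) (R b) rfl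
      -- By `hpolar`, `a` is a point of the polar of its own interpretation; validity moves it into
      -- the interpretation of `b`.
      exact key b (hnnf b hb) hb _ (this (hpolar a ha))
  · rintro _ ⟨q, hqA, rfl⟩
    induction q using Sym2.ind with
    | _ a b =>
      have ha := hAF _ hqA a (by simp)
      have hb := hAF _ hqA b (by simp)
      refine (valid_mk sequentRel_symm polar_polar_canonicalVal).2 fun w hw => ?_
      refine hmem b hb w (hw ⟨b, (hinv b hb).1⟩ (hmem a ha _ ?_))
      rw [Sym2.eq_swap]
      exact hA hqA

end Saturation

/-! ### The sets `SF` and `AF` -/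

section Algorithm

variable {V : Type*} [DecidableEq V]

section Subformulas

variable {A : Finset (Sequent V)} {goal : Sequent V}

theorem mem_sequent_subformulas {q : Sequent V} {φ : Formula V} :
    φ ∈ q.subformulas ↔ ∃ ψ ∈ q, φ ∈ ψ.subformulas := by
  simp [Sequent.subformulas]

theorem mem_allSubformulas {φ : Formula V} :
    φ ∈ allSubformulas A goal ↔ ∃ q, (q = goal ∨ q ∈ A) ∧ ∃ ψ ∈ q,
      φ ∈ ψ.subformulas ∨ ∃ χ ∈ ψ.subformulas, φ ∈ (getInverse χ).subformulas := by
  simp only [allSubformulas, Finset.mem_union, Finset.mem_biUnion, mem_sequent_subformulas]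
  constructor
  · rintro ((⟨ψ, h₁, h₂⟩ | ⟨q, hq, ψ, h₁, h₂⟩) | ⟨χ, (⟨ψ, h₁, h₂⟩ | ⟨q, hq, ψ, h₁, h₂⟩), h₃⟩)
    exacts [⟨_, .inl rfl, ψ, h₁, .inl h₂⟩, ⟨q, .inr hq, ψ, h₁, .inl h₂⟩,
      ⟨_, .inl rfl, ψ, h₁, .inr ⟨χ, h₂, h₃⟩⟩, ⟨q, .inr hq, ψ, h₁, .inr ⟨χ, h₂, h₃⟩⟩]
  · rintro ⟨q, rfl | hq, ψ, h₁, h₂ | ⟨χ, h₂, h₃⟩⟩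
    exacts [.inl (.inl ⟨ψ, h₁, h₂⟩), .inr ⟨χ, .inl ⟨ψ, h₁, h₂⟩, h₃⟩,
      .inl (.inr ⟨q, hq, ψ, h₁, h₂⟩), .inr ⟨χ, .inr ⟨q, hq, ψ, h₁, h₂⟩, h₃⟩]

theorem mem_allSubformulas_of_mem_subformulas {φ ψ : Formula V} (hφ : φ ∈ allSubformulas A goal)
    (hψ : ψ ∈ φ.subformulas) : ψ ∈ allSubformulas A goal := by
  rw [mem_allSubformulas] at *
  obtain ⟨q, hq, χ, hχ, h | ⟨ξ, hξ, h⟩⟩ := hφ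
  exacts [⟨q, hq, χ, hχ, .inl (subformulas_subset h hψ)⟩,
    ⟨q, hq, χ, hχ, .inr ⟨ξ, hξ, subformulas_subset h hψ⟩⟩]

theorem isNNF_of_mem_allSubformulas (hA : ∀ q ∈ A, q.IsNNF) (hs : goal.IsNNF) {φ : Formula V}
    (hφ : φ ∈ allSubformulas A goal) : φ.IsNNF := by
  obtain ⟨q, hq, χ, hχ, h | ⟨ξ, hξ, h⟩⟩ := mem_allSubformulas.1 hφ
  · refine IsNNF.of_mem_subformulas ?_ h
    rcases hq with rfl | hq
    exacts [hs _ hχ, hA _ hq _ hχ]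
  · exact (isNNF_getInverse ξ).of_mem_subformulas h

theorem mem_allSubformulas_of_mem_goal {φ : Formula V} (h : φ ∈ goal) :
    φ ∈ allSubformulas A goal :=
  mem_allSubformulas.2 ⟨goal, .inl rfl, φ, h, .inl (mem_subformulas_self φ)⟩

theorem mem_allSubformulas_of_axiom_mem {q : Sequent V} (hq : q ∈ A) {φ : Formula V} (h : φ ∈ q) :
    φ ∈ allSubformulas A goal :=
  mem_allSubformulas.2 ⟨q, .inr hq, φ, h, .inl (mem_subformulas_self φ)⟩

theorem getInverse_mem_allSubformulas_of_axiom_mem {q : Sequent V} (hq : q ∈ A) {φ : Formula V}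
    (h : φ ∈ q) : getInverse φ ∈ allSubformulas A goal :=
  mem_allSubformulas.2 ⟨q, .inr hq, φ, h,
    .inr ⟨φ, mem_subformulas_self φ, mem_subformulas_self _⟩⟩

/-- Normal forms keep the variables, so `x` is already a subformula of the goal or an axiom, and its
inverse `¬x` is then in `SF` too. -/
theorem var_mem_allSubformulas {x : V} {φ : Formula V} (hφ : φ ∈ allSubformulas A goal)
    (hx : x ∈ φ.vars) :
    var x ∈ allSubformulas A goal ∧ neg (var x) ∈ allSubformulas A goal := by
  refine ⟨mem_allSubformulas_of_mem_subformulas hφ ((mem_vars_iff x φ).1 hx), ?_⟩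
  obtain ⟨q, hq, χ, hχ, h⟩ := mem_allSubformulas.1 hφ
  refine mem_allSubformulas.2 ⟨q, hq, χ, hχ, .inr ⟨var x, ?_, by
    simp [getInverse, nnf, nnfPol, subformulas]⟩⟩
  rcases h with h | ⟨ξ, hξ, h⟩
  · exact subformulas_subset h ((mem_vars_iff x φ).1 hx)
  · refine subformulas_subset hξ ((mem_vars_iff x ξ).1 ?_)
    have := subformulas_subset h ((mem_vars_iff x φ).1 hx)
    rwa [← mem_vars_iff, getInverse_eq_nnfPol, vars_nnfPol] at this

theorem mem_axiomFormulas {φ : Formula V} :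
    φ ∈ axiomFormulas A ↔ ∃ q ∈ A, φ ∈ q ∨ ∃ ψ ∈ q, getInverse ψ = φ := by
  simp [axiomFormulas]

theorem getInverse_mem_axiomFormulas (hA : ∀ q ∈ A, q.IsNNF) {φ : Formula V}
    (h : φ ∈ axiomFormulas A) : getInverse φ ∈ axiomFormulas A := by
  rw [mem_axiomFormulas] at *
  obtain ⟨q, hq, h | ⟨ψ, h, rfl⟩⟩ := h
  · exact ⟨q, hq, .inr ⟨φ, h, rfl⟩⟩
  · exact ⟨q, hq, .inl (by rwa [getInverse_getInverse (hA q hq ψ h)])⟩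

theorem mem_allSubformulas_of_mem_axiomFormulas {φ : Formula V} (h : φ ∈ axiomFormulas A) :
    φ ∈ allSubformulas A goal := by
  obtain ⟨q, hq, hφ | ⟨ψ, hψ, rfl⟩⟩ := mem_axiomFormulas.1 h
  exacts [mem_allSubformulas_of_axiom_mem hq hφ,
    getInverse_mem_allSubformulas_of_axiom_mem hq hψ]

theorem mem_initialSequents {q : Sequent V} :
    q ∈ initialSequents A goal ↔ q ∈ A ∨
      ∃ x, (∃ φ ∈ allSubformulas A goal, x ∈ φ.vars) ∧ s(var x, neg (var x)) = q := by
  simp [initialSequents, getInverse, nnf, nnfPol]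

theorem initialSequents_subset_sym2 :
    initialSequents A goal ⊆ (allSubformulas A goal).sym2 := by
  intro q hq
  rw [Finset.mem_sym2_iff]
  rcases mem_initialSequents.1 hq with hq | ⟨x, ⟨φ, hφ, hx⟩, rfl⟩
  · exact fun φ hφ => mem_allSubformulas_of_axiom_mem hq hφ
  · simpa using var_mem_allSubformulas hφ hx

theorem rightProvable_of_mem_initialSequents {q : Sequent V} (hq : q ∈ initialSequents A goal) :
    RightProvable (A : Set (Sequent V)) q := by
  rcases mem_initialSequents.1 hq with hq | ⟨x, _, rfl⟩
  exacts [.ax hq, .hyp x]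

theorem mem_orMap {SF : Finset (Formula V)} {a φ : Formula V} :
    φ ∈ orMap SF a ↔ φ ∈ SF ∧ ∃ ψ, φ = disj a ψ ∨ φ = disj ψ a := by
  simp only [orMap, Finset.mem_biUnion]
  constructor
  · rintro ⟨χ, hχ, h⟩
    cases χ with
    | disj χ₁ χ₂ =>
      simp only at h
      split_ifs at h with h'
      · obtain rfl := Finset.mem_singleton.1 h
        rcases h' with rfl | rfl
        exacts [⟨hχ, _, .inl rfl⟩, ⟨hχ, _, .inr rfl⟩]
      · simp at h
    | _ => simp at h
  · rintro ⟨h, ψ, rfl | rfl⟩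
    · exact ⟨_, h, by simp⟩
    · exact ⟨_, h, by simp⟩

theorem mem_andMap {SF : Finset (Formula V)} {a ψ : Formula V} :
    ψ ∈ andMap SF a ↔ conj a ψ ∈ SF ∨ conj ψ a ∈ SF := by
  simp only [andMap, Finset.mem_biUnion]
  constructor
  · rintro ⟨χ, hχ, h⟩
    cases χ with
    | conj χ₁ χ₂ =>
      simp only [Finset.mem_union] at h
      rcases h with h | h <;> split_ifs at h with h'
      · obtain rfl := Finset.mem_singleton.1 h
        subst h'
        exact .inl hχ
      · simp at h
      · obtain rfl := Finset.mem_singleton.1 h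
        subst h'
        exact .inr hχ
      · simp at h
    | _ => simp at h
  · rintro (h | h)
    · exact ⟨_, h, by simp⟩
    · exact ⟨_, h, by simp⟩

end Subformulas

/-! ### Effect of one iteration on the state -/

namespace State

/-- `τ` arises from `σ` by adding the sequents of `N` to `proven` and pushing the new ones on the
worklist. -/
structure Extends (N : Finset (Sequent V)) (σ τ : State V) : Prop where
  PCut_eq : τ.PCut = σ.PCut
  PAnd_eq : τ.PAnd = σ.PAnd
  proven_eq : τ.proven = σ.proven ∪ N
  mem_worklist : ∀ q, q ∈ τ.worklist ↔ q ∈ σ.worklist ∨ q ∈ N ∧ q ∉ σ.proven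
  card_add_length : ∀ U, N ⊆ U → (U \ τ.proven).card + τ.worklist.length =
    (U \ σ.proven).card + σ.worklist.length

theorem Extends.refl (σ : State V) : Extends ∅ σ σ where
  PCut_eq := rfl
  PAnd_eq := rfl
  proven_eq := by simp
  mem_worklist := by simp
  card_add_length _ _ := rfl

theorem Extends.trans {M N : Finset (Sequent V)} {ρ σ τ : State V} (h₁ : Extends M ρ σ)
    (h₂ : Extends N σ τ) : Extends (M ∪ N) ρ τ where
  PCut_eq := h₂.PCut_eq.trans h₁.PCut_eq
  PAnd_eq := h₂.PAnd_eq.trans h₁.PAnd_eq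
  proven_eq := by rw [h₂.proven_eq, h₁.proven_eq, Finset.union_assoc]
  mem_worklist q := by
    rw [h₂.mem_worklist, h₁.mem_worklist, h₁.proven_eq]
    simp only [Finset.mem_union]
    tauto
  card_add_length U hU :=
    (h₂.card_add_length U (Finset.subset_union_right.trans hU)).trans
      (h₁.card_add_length U (Finset.subset_union_left.trans hU))

theorem extends_tryAdd (σ : State V) (q : Sequent V) : Extends {q} σ (σ.tryAdd q) := by
  unfold tryAdd
  split_ifs with h
  · refine ⟨rfl, rfl, ?_, fun p => ?_, fun _ _ => rfl⟩
    · exact (Finset.union_eq_left.2 (Finset.singleton_subset_iff.2 h)).symm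
    · simp only [Finset.mem_singleton]
      constructor
      · exact .inl
      · rintro (hp | ⟨rfl, hp⟩)
        exacts [hp, absurd h hp]
  · refine ⟨rfl, rfl, ?_, fun p => ?_, fun U hU => ?_⟩
    · rw [Finset.insert_eq, Finset.union_comm]
    · simp only [List.mem_cons, Finset.mem_singleton]
      constructor
      · rintro (rfl | hp)
        exacts [.inr ⟨rfl, h⟩, .inl hp]
      · rintro (hp | ⟨rfl, _⟩)
        exacts [.inr hp, .inl rfl]
    -- The new sequent leaves `U \ proven` and enters the worklist, so the sum is unchanged.
    · have hq : q ∈ U \ σ.proven := Finset.mem_sdiff.2 ⟨hU (Finset.mem_singleton_self q), h⟩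
      have := Finset.card_erase_add_one hq
      simp only [List.length_cons, Finset.sdiff_insert]
      omega

theorem extends_foldl_tryAdd (f : Formula V → Sequent V) (l : List (Formula V)) (σ : State V) :
    Extends (l.toFinset.image f) σ (l.foldl (fun ρ φ => ρ.tryAdd (f φ)) σ) := by
  induction l generalizing σ with
  | nil => exact .refl σ
  | cons φ l ih =>
    rw [List.toFinset_cons, Finset.image_insert, Finset.insert_eq]
    exact (extends_tryAdd σ (f φ)).trans (ih _)

theorem AddEach.extends {S : Finset (Formula V)} {f : Formula V → Sequent V} {σ τ : State V}
    (h : AddEach S f σ τ) : Extends (S.image f) σ τ := by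
  obtain ⟨l, _, rfl, rfl⟩ := h
  exact extends_foldl_tryAdd f l σ

theorem exists_addEach (S : Finset (Formula V)) (f : Formula V → Sequent V) (σ : State V) :
    ∃ τ, AddEach S f σ τ :=
  ⟨_, S.toList, S.nodup_toList, by simp, rfl⟩

theorem mem_PCut_recordCut {AF : Finset (Formula V)} {a b c d : Formula V} {σ : State V} :
    c ∈ (σ.recordCut AF a b).PCut d ↔ c ∈ σ.PCut d ∨ a ∈ AF ∧ d = getInverse a ∧ c = b := by
  unfold recordCut
  split_ifs with h
  · by_cases hd : d = getInverse a
    · subst hd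
      simp [h, or_comm]
    · simp [hd]
  · simp [h]

theorem mem_PAnd_recordAnd {SF : Finset (Formula V)} {a b c ψ χ : Formula V} {σ : State V} :
    χ ∈ (σ.recordAnd SF a b).PAnd c ψ ↔
      χ ∈ σ.PAnd c ψ ∨ c = b ∧ χ ∈ SF ∧ (χ = conj a ψ ∨ χ = conj ψ a) := by
  simp only [recordAnd]
  split_ifs with h
  · simp only [Finset.mem_union, Finset.mem_inter, Finset.mem_insert, Finset.mem_singleton, h.1,
      true_and]
    tauto
  · constructor
    · exact .inl
    · rintro (hχ | ⟨hc, hχ, hχ'⟩)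
      · exact hχ
      -- The guard `ψ ∈ andMap SF a` is implied by `χ ∈ SF`.
      · refine absurd ⟨hc, mem_andMap.2 ?_⟩ h
        rcases hχ' with rfl | rfl
        exacts [.inl hχ, .inr hχ]

/-- The state after the popped sequent `(a, b)` has been recorded, `w` being the rest of the
worklist. -/
def record (A : Finset (Sequent V)) (goal : Sequent V) (a b : Formula V) (w : List (Sequent V))
    (σ : State V) : State V :=
  ((((({ σ with worklist := w } : State V).recordCut (axiomFormulas A) a b).recordCut
    (axiomFormulas A) b a).recordAnd (allSubformulas A goal) a b).recordAnd
    (allSubformulas A goal) b a)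

section Record

variable {A : Finset (Sequent V)} {goal : Sequent V} {a b : Formula V} {w : List (Sequent V)}
  {σ : State V}

theorem proven_record : (σ.record A goal a b w).proven = σ.proven := by
  simp only [record, recordAnd, recordCut]
  split_ifs <;> rfl

theorem worklist_record : (σ.record A goal a b w).worklist = w := by
  simp only [record, recordAnd, recordCut]
  split_ifs <;> rfl

theorem mem_PCut_record {c d : Formula V} :
    c ∈ (σ.record A goal a b w).PCut d ↔ c ∈ σ.PCut d ∨
      ∃ e, s(e, c) = s(a, b) ∧ e ∈ axiomFormulas A ∧ d = getInverse e := by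
  change c ∈ (((State.recordCut _ a b _).recordCut _ b a).PCut d) ↔ _
  rw [mem_PCut_recordCut, mem_PCut_recordCut, or_assoc]
  refine or_congr Iff.rfl ?_
  simp only [Sym2.eq_iff]
  constructor
  · rintro (⟨h₁, h₂, rfl⟩ | ⟨h₁, h₂, rfl⟩)
    exacts [⟨a, .inl ⟨rfl, rfl⟩, h₁, h₂⟩, ⟨b, .inr ⟨rfl, rfl⟩, h₁, h₂⟩]
  · rintro ⟨e, ⟨rfl, rfl⟩ | ⟨rfl, rfl⟩, h₁, h₂⟩
    exacts [.inl ⟨h₁, h₂, rfl⟩, .inr ⟨h₁, h₂, rfl⟩]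

theorem mem_PAnd_record {c ψ χ : Formula V} :
    χ ∈ (σ.record A goal a b w).PAnd c ψ ↔ χ ∈ σ.PAnd c ψ ∨
      χ ∈ allSubformulas A goal ∧ ∃ e, s(e, c) = s(a, b) ∧ (χ = conj e ψ ∨ χ = conj ψ e) := by
  have h : ∀ τ : State V, ∀ AF : Finset (Formula V), ∀ a b, (τ.recordCut AF a b).PAnd = τ.PAnd := by
    intro τ AF a b
    unfold recordCut
    split_ifs <;> rfl
  rw [record, mem_PAnd_recordAnd, mem_PAnd_recordAnd, h, h, or_assoc]
  refine or_congr Iff.rfl ?_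
  simp only [Sym2.eq_iff]
  constructor
  · rintro (⟨rfl, h₁, h₂⟩ | ⟨rfl, h₁, h₂⟩)
    exacts [⟨h₁, a, .inl ⟨rfl, rfl⟩, h₂⟩, ⟨h₁, b, .inr ⟨rfl, rfl⟩, h₂⟩]
  · rintro ⟨h₁, e, ⟨rfl, rfl⟩ | ⟨rfl, rfl⟩, h₂⟩
    exacts [.inl ⟨rfl, h₁, h₂⟩, .inr ⟨rfl, h₁, h₂⟩]

end Record

theorem mem_consequences {SF : Finset (Formula V)} {σ : State V} {a b φ : Formula V} :
    φ ∈ σ.consequences SF a b ↔ φ ∈ orMap SF a ∨ φ ∈ σ.PAnd b a ∨ φ ∈ σ.PCut a := by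
  simp [consequences]

theorem Extends.consequences_eq {N : Finset (Sequent V)} {σ τ : State V} (h : Extends N σ τ)
    (SF : Finset (Formula V)) (a b : Formula V) :
    τ.consequences SF a b = σ.consequences SF a b := by
  rw [consequences, consequences, h.PAnd_eq, h.PCut_eq]

/-- One iteration adds all immediate consequences of the popped sequent. -/
theorem exists_extends_of_addEach {SF : Finset (Formula V)} {a b : Formula V}
    {σ₀ σ₁ σ₂ σ₃ : State V}
    (h₁ : σ₀.AddEach (σ₀.consequences SF a b) (fun φ => s(φ, b)) σ₁)
    (h₂ : σ₁.AddEach (σ₁.consequences SF b a) (fun φ => s(a, φ)) σ₂)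
    (h₃ : σ₂.AddEach (if a = b then SF else ∅) (fun φ => s(φ, a)) σ₃) :
    ∃ N, Extends N σ₀ σ₃ ∧ ∀ q, q ∈ N ↔ ∃ c d φ, s(c, d) = s(a, b) ∧
      (φ ∈ σ₀.consequences SF c d ∨ c = d ∧ φ ∈ SF) ∧ s(φ, d) = q := by
  -- The tables do not change while sequents are added, so both rounds draw on those of `σ₀`.
  rw [h₁.extends.consequences_eq] at h₂
  refine ⟨_, (h₁.extends.trans h₂.extends).trans h₃.extends, fun q => ?_⟩
  simp only [Finset.mem_union, Finset.mem_image]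
  constructor
  · rintro ((⟨φ, h, rfl⟩ | ⟨φ, h, rfl⟩) | ⟨φ, h, rfl⟩)
    · exact ⟨a, b, φ, rfl, .inl h, rfl⟩
    · exact ⟨b, a, φ, Sym2.eq_swap, .inl h, Sym2.eq_swap⟩
    · split_ifs at h with hab
      · subst hab
        exact ⟨a, a, φ, rfl, .inr ⟨rfl, h⟩, rfl⟩
      · simp at h
  · rintro ⟨c, d, φ, hcd, h, rfl⟩
    rcases h with h | ⟨rfl, h⟩
    · rcases Sym2.eq_iff.1 hcd with ⟨rfl, rfl⟩ | ⟨rfl, rfl⟩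
      · exact .inl (.inl ⟨φ, h, rfl⟩)
      · exact .inl (.inr ⟨φ, h, Sym2.eq_swap⟩)
    · obtain ⟨rfl, rfl⟩ : c = a ∧ c = b := by
        rcases Sym2.eq_iff.1 hcd with h | h
        exacts [h, h.symm]
      exact .inr ⟨φ, by simpa using h, rfl⟩

/-- A sequent is done if it has been added and no longer awaits processing. -/
def Done (σ : State V) (q : Sequent V) : Prop := q ∈ σ.proven ∧ q ∉ σ.worklist

/-- The loop invariant: recorded data is sound, and `proven` contains all immediate consequences of
the sequents that are done. -/
structure Invariant (A : Finset (Sequent V)) (goal : Sequent V) (σ : State V) : Prop where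
  initial_subset : initialSequents A goal ⊆ σ.proven
  subset_sym2 : σ.proven ⊆ (allSubformulas A goal).sym2
  worklist_subset : ∀ q ∈ σ.worklist, q ∈ σ.proven
  sound : ∀ q ∈ σ.proven, RightProvable (A : Set (Sequent V)) q
  PCut_sound : ∀ c d, c ∈ σ.PCut d → c ∈ allSubformulas A goal ∧
    ∃ e, getInverse e = d ∧ RightProvable (A : Set (Sequent V)) s(e, c)
  PAnd_sound : ∀ χ c ψ, χ ∈ σ.PAnd c ψ → χ ∈ allSubformulas A goal ∧
    ∃ e, RightProvable (A : Set (Sequent V)) s(e, c) ∧ (χ = conj e ψ ∨ χ = conj ψ e)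
  not_done_goal : ¬ σ.Done goal
  PCut_complete : ∀ e c, σ.Done s(e, c) → e ∈ axiomFormulas A → c ∈ σ.PCut (getInverse e)
  PAnd_complete : ∀ e c ψ χ, σ.Done s(e, c) → χ ∈ allSubformulas A goal →
    (χ = conj e ψ ∨ χ = conj ψ e) → χ ∈ σ.PAnd c ψ
  or_closed : ∀ c d φ, σ.Done s(c, d) → φ ∈ orMap (allSubformulas A goal) c → s(φ, d) ∈ σ.proven
  replace_closed : ∀ c φ, σ.Done s(c, c) → φ ∈ allSubformulas A goal → s(φ, c) ∈ σ.proven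
  cut_closed : ∀ e c d, e ∈ axiomFormulas A → σ.Done s(e, c) → σ.Done s(getInverse e, d) →
    s(c, d) ∈ σ.proven
  and_closed : ∀ c ψ d, σ.Done s(c, d) → σ.Done s(ψ, d) → conj c ψ ∈ allSubformulas A goal →
    s(conj c ψ, d) ∈ σ.proven

variable {A : Finset (Sequent V)} {goal : Sequent V}

/-- Everything proven still waits on the worklist, so nothing is done and the closure clauses are
vacuous. -/
theorem IsInitial.invariant {σ : State V} (h : σ.IsInitial A goal) : σ.Invariant A goal := by
  obtain ⟨hp, _, hw, hc, ha⟩ := h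
  have hd : ∀ q, ¬ σ.Done q := fun q hq =>
    hq.2 (by rw [← List.mem_toFinset, hw, ← hp]; exact hq.1)
  have hpw : ∀ q, q ∈ σ.worklist ↔ q ∈ σ.proven := fun q => by
    rw [← List.mem_toFinset, hw, hp]
  constructor
  · exact hp.superset
  · exact hp.subset.trans initialSequents_subset_sym2
  · exact fun q hq => (hpw q).1 hq
  · exact fun q hq => rightProvable_of_mem_initialSequents (hp.subset hq)
  · simp [hc]
  · simp [ha]
  · exact hd _
  · exact fun _ _ h => absurd h (hd _)
  · exact fun _ _ _ _ h => absurd h (hd _)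
  · exact fun _ _ _ h => absurd h (hd _)
  · exact fun _ _ h => absurd h (hd _)
  · exact fun _ _ _ _ h => absurd h (hd _)
  · exact fun _ _ _ h => absurd h (hd _)

theorem exists_isInitial (A : Finset (Sequent V)) (goal : Sequent V) :
    ∃ σ : State V, σ.IsInitial A goal :=
  ⟨⟨initialSequents A goal, (initialSequents A goal).toList, fun _ => ∅, fun _ _ => ∅⟩,
    rfl, Finset.nodup_toList _, by simp, rfl, rfl⟩

/-- The closure clauses can only fail for inferences with the popped sequent as a premise. Since it
is recorded before consequences are computed, the tables hold the other premise, even when both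
premises are the popped sequent. -/
theorem Invariant.iterate (hA : ∀ q ∈ A, q.IsNNF) (hs : goal.IsNNF) {σ τ : State V}
    (hσ : σ.Invariant A goal) {a b : Formula V} {w : List (Sequent V)}
    (hw : σ.worklist = s(a, b) :: w) (hne : s(a, b) ≠ goal) {N : Finset (Sequent V)}
    (hN : Extends N (σ.record A goal a b w) τ)
    (hmem : ∀ q, q ∈ N ↔ ∃ c d φ, s(c, d) = s(a, b) ∧
      (φ ∈ (σ.record A goal a b w).consequences (allSubformulas A goal) c d ∨
        c = d ∧ φ ∈ allSubformulas A goal) ∧ s(φ, d) = q) :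
    N ⊆ (allSubformulas A goal).sym2 ∧ τ.Invariant A goal := by
  have hproven : τ.proven = σ.proven ∪ N := by rw [hN.proven_eq, proven_record]
  have hwork : ∀ q, q ∈ τ.worklist ↔ q ∈ w ∨ q ∈ N ∧ q ∉ σ.proven := by
    intro q
    rw [hN.mem_worklist, worklist_record, proven_record]
  have hPCut := hN.PCut_eq
  have hPAnd := hN.PAnd_eq
  have hpq : s(a, b) ∈ σ.proven := hσ.worklist_subset _ (by simp [hw])
  have hmono : ∀ q ∈ σ.proven, q ∈ τ.proven := fun q hq => by
    rw [hproven]; exact Finset.mem_union_left _ hq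
  have hadd : ∀ c d φ, s(c, d) = s(a, b) →
      (φ ∈ (σ.record A goal a b w).consequences (allSubformulas A goal) c d ∨
        c = d ∧ φ ∈ allSubformulas A goal) → s(φ, d) ∈ τ.proven := fun c d φ h₁ h₂ => by
    rw [hproven]
    exact Finset.mem_union_right _ ((hmem _).2 ⟨c, d, φ, h₁, h₂, rfl⟩)
  -- Newly added sequents are on the worklist, so only the popped one can become done.
  have hdone : ∀ q, τ.Done q → σ.Done q ∨ q = s(a, b) := by
    rintro q ⟨h₁, h₂⟩
    rw [hwork, not_or] at h₂
    by_cases hq : q = s(a, b)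
    · exact .inr hq
    · have : q ∈ σ.proven := by
        by_contra hq'
        rw [hproven, Finset.mem_union] at h₁
        exact h₂.2 ⟨h₁.resolve_left hq', hq'⟩
      exact .inl ⟨this, by simp [hw, hq, h₂.1]⟩
  have hSF : ∀ c d, s(c, d) ∈ σ.proven →
      c ∈ allSubformulas A goal ∧ d ∈ allSubformulas A goal := fun c d h => by
    simpa using hσ.subset_sym2 h
  have hPCut_sound : ∀ c d, c ∈ τ.PCut d → c ∈ allSubformulas A goal ∧
      ∃ e, getInverse e = d ∧ RightProvable (A : Set (Sequent V)) s(e, c) := by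
    intro c d h
    rw [hPCut, mem_PCut_record] at h
    rcases h with h | ⟨e, he, _, rfl⟩
    · exact hσ.PCut_sound c d h
    · rw [← he] at hpq
      exact ⟨(hSF _ _ hpq).2, e, rfl, hσ.sound _ hpq⟩
  have hPAnd_sound : ∀ χ c ψ, χ ∈ τ.PAnd c ψ → χ ∈ allSubformulas A goal ∧
      ∃ e, RightProvable (A : Set (Sequent V)) s(e, c) ∧ (χ = conj e ψ ∨ χ = conj ψ e) := by
    intro χ c ψ h
    rw [hPAnd, mem_PAnd_record] at h
    rcases h with h | ⟨h, e, he, h'⟩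
    · exact hσ.PAnd_sound χ c ψ h
    · rw [← he] at hpq
      exact ⟨h, e, hσ.sound _ hpq, h'⟩
  have hPCut_complete : ∀ e c, τ.Done s(e, c) → e ∈ axiomFormulas A →
      c ∈ (σ.record A goal a b w).PCut (getInverse e) := by
    intro e c h he
    rw [mem_PCut_record]
    rcases hdone _ h with h | h
    exacts [.inl (hσ.PCut_complete e c h he), .inr ⟨e, h, he, rfl⟩]
  have hPAnd_complete : ∀ e c ψ χ, τ.Done s(e, c) → χ ∈ allSubformulas A goal →
      (χ = conj e ψ ∨ χ = conj ψ e) → χ ∈ (σ.record A goal a b w).PAnd c ψ := by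
    intro e c ψ χ h hχ hχ'
    rw [mem_PAnd_record]
    rcases hdone _ h with h | h
    exacts [.inl (hσ.PAnd_complete e c ψ χ h hχ hχ'), .inr ⟨hχ, e, h, hχ'⟩]
  have hnew : ∀ q ∈ N, q ∈ (allSubformulas A goal).sym2 ∧
      RightProvable (A : Set (Sequent V)) q := by
    intro q hq
    obtain ⟨c, d, φ, hcd, h, rfl⟩ := (hmem q).1 hq
    rw [← hcd] at hpq
    have hd := (hSF _ _ hpq).2
    have hprov := hσ.sound _ hpq
    have hnnf : ∀ {φ}, φ ∈ allSubformulas A goal → φ.IsNNF :=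
      fun h => isNNF_of_mem_allSubformulas hA hs h
    suffices φ ∈ allSubformulas A goal ∧ RightProvable (A : Set (Sequent V)) s(d, φ) from
      ⟨by simp [this.1, hd], this.2.swap⟩
    rw [mem_consequences, ← hPCut, ← hPAnd] at h
    rcases h with (h | h | h) | ⟨rfl, h⟩
    · obtain ⟨hφ, ψ, rfl | rfl⟩ := mem_orMap.1 h
      · exact ⟨hφ, .or_right₁ _ (hnnf hφ).2 hprov.swap⟩
      · exact ⟨hφ, .or_right₂ _ (hnnf hφ).1 hprov.swap⟩
    · obtain ⟨hφ, e, he, rfl | rfl⟩ := hPAnd_sound _ _ _ h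
      · exact ⟨hφ, .and_right he.swap hprov.swap⟩
      · exact ⟨hφ, .and_right hprov.swap he.swap⟩
    · obtain ⟨hφ, e, rfl, he⟩ := hPCut_sound _ _ h
      exact ⟨hφ, .swap (.cut e he.swap hprov)⟩
    · exact ⟨h, .replace _ (hnnf h) hprov⟩
  refine ⟨fun q hq => (hnew q hq).1, ?_⟩
  constructor
  · exact fun q hq => hmono q (hσ.initial_subset hq)
  · rw [hproven]
    exact Finset.union_subset hσ.subset_sym2 fun q hq => (hnew q hq).1
  · intro q hq
    rw [hproven, Finset.mem_union]
    rcases (hwork q).1 hq with hq | hq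
    exacts [.inl (hσ.worklist_subset q (by simp [hw, hq])), .inr hq.1]
  · intro q hq
    rw [hproven, Finset.mem_union] at hq
    exact hq.elim (hσ.sound q) fun hq => (hnew q hq).2
  · exact hPCut_sound
  · exact hPAnd_sound
  · intro h
    rcases hdone _ h with h | h
    exacts [hσ.not_done_goal h, hne h.symm]
  · rw [hPCut]; exact hPCut_complete
  · rw [hPAnd]; exact hPAnd_complete
  · intro c d φ h hφ
    rcases hdone _ h with h | h
    · exact hmono _ (hσ.or_closed c d φ h hφ)
    · exact hadd c d φ h (.inl (mem_consequences.2 (.inl hφ)))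
  · intro c φ h hφ
    rcases hdone _ h with h | h
    · exact hmono _ (hσ.replace_closed c φ h hφ)
    · exact hadd c c φ h (.inr ⟨rfl, hφ⟩)
  · intro e c d he h₁ h₂
    have hinv : getInverse (getInverse e) = e := getInverse_getInverse
      (isNNF_of_mem_allSubformulas hA hs (mem_allSubformulas_of_mem_axiomFormulas he))
    rcases hdone _ h₁ with h₁' | h₁'
    · rcases hdone _ h₂ with h₂' | h₂'
      · exact hmono _ (hσ.cut_closed e c d he h₁' h₂')
      · exact hadd _ d c h₂' (.inl (mem_consequences.2 (.inr (.inr (hPCut_complete e c h₁ he)))))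
    -- The popped premise contains `e`. The other one was recorded under the inverse of the inverse
    -- of `e`, which is `e` as `e` is in NNF.
    · have := hPCut_complete _ d h₂ (getInverse_mem_axiomFormulas hA he)
      rw [hinv] at this
      rw [Sym2.eq_swap]
      exact hadd e c d h₁' (.inl (mem_consequences.2 (.inr (.inr this))))
  · intro c ψ d h₁ h₂ hφ
    rcases hdone _ h₁ with h₁' | h₁'
    · rcases hdone _ h₂ with h₂' | h₂'
      · exact hmono _ (hσ.and_closed c ψ d h₁' h₂' hφ)
      · exact hadd ψ d _ h₂' (.inl (mem_consequences.2
          (.inr (.inl (hPAnd_complete c d ψ _ h₁ hφ (.inl rfl))))))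
    · exact hadd c d _ h₁' (.inl (mem_consequences.2
          (.inr (.inl (hPAnd_complete ψ d c _ h₂ hφ (.inr rfl))))))

/-- When the worklist is exhausted, the set `proven` is saturated. -/
theorem Invariant.saturated {σ : State V} (hσ : σ.Invariant A goal) (hw : σ.worklist = []) :
    Saturated (allSubformulas A goal : Set (Formula V)) (axiomFormulas A : Set (Formula V))
      (σ.proven : Set (Sequent V)) := by
  have hdone : ∀ c d, s(c, d) ∈ (σ.proven : Set (Sequent V)) →
      σ.Done s(c, d) ∧ σ.Done s(d, c) := fun c d h => by
    rw [Sym2.eq_swap (a := d)]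
    exact ⟨⟨h, by simp [hw]⟩, ⟨h, by simp [hw]⟩⟩
  constructor
  · exact fun x hx => hσ.initial_subset (mem_initialSequents.2
      (.inr ⟨x, ⟨var x, hx, by simp [vars]⟩, rfl⟩))
  · exact fun a ha b c h₁ h₂ => hσ.cut_closed a b c ha (hdone _ _ h₁).2 (hdone _ _ h₂).1
  · intro a h b hb
    rw [Sym2.eq_swap]
    exact hσ.replace_closed a b (hdone _ _ h).1 hb
  · intro a b c h h₁ h₂
    rw [Sym2.eq_swap]
    exact hσ.and_closed a b c (hdone _ _ h₁).2 (hdone _ _ h₂).2 h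
  · intro a b c h h₁
    rw [Sym2.eq_swap]
    exact hσ.or_closed a c _ (hdone _ _ h₁).2 (mem_orMap.2 ⟨h, b, .inl rfl⟩)
  · intro a b c h h₁
    rw [Sym2.eq_swap]
    exact hσ.or_closed b c _ (hdone _ _ h₁).2 (mem_orMap.2 ⟨h, a, .inr rfl⟩)

theorem Invariant.goal_mem_proven (hA : ∀ q ∈ A, q.IsNNF) (hs : goal.IsNNF) {σ : State V}
    (hσ : σ.Invariant A goal) (hw : σ.worklist = [])
    (h : Provable (Sequent.toAnnotated '' (A : Set (Sequent V))) goal.toAnnotated) :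
    goal ∈ σ.proven :=
  (hσ.saturated hw).complete
    (fun _ hφ _ hψ => mem_allSubformulas_of_mem_subformulas hφ hψ)
    (fun _ hφ => isNNF_of_mem_allSubformulas hA hs hφ)
    (fun _ hφ => ⟨mem_allSubformulas_of_mem_axiomFormulas hφ,
      mem_allSubformulas_of_mem_axiomFormulas (getInverse_mem_axiomFormulas hA hφ)⟩)
    (fun _ hq => hσ.initial_subset (mem_initialSequents.2 (.inl hq)))
    (fun q hq _ hφ => mem_axiomFormulas.2 ⟨q, hq, .inl hφ⟩)
    (fun _ hφ => mem_allSubformulas_of_mem_goal hφ) h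

end State

/-! ### Runs of the procedure -/

variable {A : Finset (Sequent V)} {goal : Sequent V}

theorem exists_step (A : Finset (Sequent V)) (goal : Sequent V) (σ : State V) :
    ∃ c, Step A goal (.running σ) c := by
  rcases hw : σ.worklist with _ | ⟨q, w⟩
  · exact ⟨_, .exhausted hw⟩
  · by_cases hq : q = goal
    · subst hq
      exact ⟨_, .found hw⟩
    · induction q using Sym2.ind with
      | _ a b =>
        obtain ⟨σ₁, h₁⟩ := State.exists_addEach _ _ (σ.record A goal a b w)
        obtain ⟨σ₂, h₂⟩ := State.exists_addEach _ _ σ₁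
        obtain ⟨σ₃, h₃⟩ := State.exists_addEach _ _ σ₂
        exact ⟨_, .iterate hw hq rfl h₁ h₂ h₃⟩

/-- `r` is arbitrary between the two notions of provability, so that it can later be chosen as
either of them. -/
theorem State.Invariant.everyRunReturns (hA : ∀ q ∈ A, q.IsNNF) (hs : goal.IsNNF) {r : Bool}
    (hsound : RightProvable (A : Set (Sequent V)) goal → r = true)
    (hcomplete : r = true →
      Provable (Sequent.toAnnotated '' (A : Set (Sequent V))) goal.toAnnotated)
    {σ : State V} (hσ : σ.Invariant A goal) : EveryRunReturns A goal r (.running σ) := by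
  induction hn : ((allSubformulas A goal).sym2 \ σ.proven).card + σ.worklist.length using
    Nat.strong_induction_on generalizing σ with
  | _ n ih =>
    refine .step (exists_step A goal σ) fun c' hc' => ?_
    cases hc' with
    | exhausted hw =>
      have : r = false := by
        by_contra hr
        -- With an empty worklist a proven goal would be done, but popping the goal ends the run.
        refine hσ.not_done_goal ⟨hσ.goal_mem_proven hA hs hw (hcomplete (by simpa using hr)), ?_⟩
        simp [hw]
      subst this
      exact .returned
    | found hw =>
      obtain rfl := hsound (hσ.sound _ (hσ.worklist_subset _ (by simp [hw])))
      exact .returned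
    | @iterate _ _ σ₁ σ₂ σ₃ a b w hw hne h₀ h₁ h₂ h₃ =>
      subst h₀
      obtain ⟨N, hN, hmem⟩ := State.exists_extends_of_addEach h₁ h₂ h₃
      obtain ⟨hsub, hinv⟩ := hσ.iterate hA hs hw hne hN hmem
      refine ih _ ?_ hinv rfl
      -- Adding consequences preserves the measure; popping had lowered it by one.
      have := hN.card_add_length _ hsub
      rw [show State.recordAnd _ _ _ _ = σ.record A goal a b w from rfl, State.proven_record,
        State.worklist_record] at this
      rw [this, ← hn, hw]
      simp

/-- Non-vacuous because `EveryRunReturns.step` demands that some step exists: both derivations can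
be followed along a common run. -/
theorem EveryRunReturns.unique {r r' : Bool} {c : Config V} (h : EveryRunReturns A goal r c)
    (h' : EveryRunReturns A goal r' c) : r = r' := by
  induction h with
  | returned =>
    cases h' with
    | returned => rfl
    | step hex _ => obtain ⟨_, ⟨⟩⟩ := hex
  | step hex _ ih =>
    obtain ⟨c', hc'⟩ := hex
    cases h' with
    | returned => cases hc'
    | step _ hall => exact ih c' hc' (hall c' hc')

theorem ProveReturns.unique {r r' : Bool} (h : ProveReturns A goal r)
    (h' : ProveReturns A goal r') : r = r' := by
  obtain ⟨σ, hσ⟩ := State.exists_isInitial A goal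
  exact (h σ hσ).unique (h' σ hσ)

/-- The procedure terminates, and its result decides both notions of provability. -/
theorem exists_proveReturns (hA : ∀ q ∈ A, q.IsNNF) (hs : goal.IsNNF) :
    ∃ r, ProveReturns A goal r ∧
      (r = true ↔ Provable (Sequent.toAnnotated '' (A : Set (Sequent V))) goal.toAnnotated) ∧
      (r = true ↔ RightProvable (A : Set (Sequent V)) goal) := by
  classical
  have h : ∀ r : Bool, (RightProvable (A : Set (Sequent V)) goal → r = true) →
      (r = true → Provable (Sequent.toAnnotated '' (A : Set (Sequent V))) goal.toAnnotated) →
      ProveReturns A goal r :=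
    fun r h₁ h₂ σ hσ => hσ.invariant.everyRunReturns hA hs h₁ h₂
  -- Both truth values are results of the procedure, so uniqueness of the result identifies the two
  -- notions of provability.
  have hR := h (decide (RightProvable (A : Set (Sequent V)) goal)) decide_eq_true
    fun hr => (of_decide_eq_true hr).provable
  have hP := h (decide (Provable (Sequent.toAnnotated '' (A : Set (Sequent V))) goal.toAnnotated))
    (fun hr => decide_eq_true hr.provable) of_decide_eq_true
  refine ⟨_, hR, ?_, decide_eq_true_iff⟩
  rw [hR.unique hP, decide_eq_true_iff]

end Algorithm

end OL

theorem mainTheorem1 {V : Type*} [DecidableEq V] (A : Finset (OL.Sequent V)) (s : OL.Sequent V)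
    (hA : ∀ q ∈ A, OL.Sequent.IsNNF q) (hs : OL.Sequent.IsNNF s) :
    (OL.ProveReturns A s true ↔
      OL.Provable (OL.Sequent.toAnnotated '' (A : Set (OL.Sequent V))) s.toAnnotated) ∧
    (OL.ProveReturns A s false ↔
      ¬ OL.Provable (OL.Sequent.toAnnotated '' (A : Set (OL.Sequent V))) s.toAnnotated) ∧
    (OL.ProveReturns A s true ↔ OL.RightProvable (A : Set (OL.Sequent V)) s) := by
  obtain ⟨r, hr, hP, hR⟩ := OL.exists_proveReturns hA hs
  have hret : ∀ r', OL.ProveReturns A s r' ↔ r = r' :=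
    fun r' => ⟨fun h => hr.unique h, fun h => h ▸ hr⟩
  rw [hret, hret, ← hP, ← hR]
  simp
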